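/- Let $q\in\mathbb C\setminus\{0\}$ with a fixed square root $q^{1/2}$, let $I\ge 1$ be an integer, and let $a,b,c,d\in\mathbb C$. For a $0/1$ word $\sigma=(\sigma_1,\dots,\sigma_I)$ put $|\sigma|=\sum_k\sigma_k$ and $\mathrm{inv}(\sigma)=\#\{i<j:\sigma_i>\sigma_j\}$, write $e_\sigma=e_{\sigma_1}\otimes\cdots\otimes e_{\sigma_I}\in(\mathbb C^2)^{\otimes I}$, and assume $Z_q(I;\zeta)=\sum_{|\sigma|=\zeta}q^{\mathrm{inv}(\sigma)}\neq 0$ for $0\le\zeta\le I$ (which is automatic for $0<q<1$). **Unfused matrices.** In the basis $e_0\otimes e_0,\,e_0\otimes e_1,\,e_1\otimes e_0,\,e_1\otimes e_1$ of $\mathbb C^2\otimes\mathbb C^2$, respectively $e_0,e_1$ of $\mathbb C^2$, let $$R(u)=\begin{bmatrix}1&0&0&0\\0&\frac{q(1-u)}{1-qu}&\frac{u(1-q)}{1-qu}&0\\0&\frac{1-q}{1-qu}&\frac{1-u}{1-qu}&0\\0&0&0&1\end{bmatrix},\quad R^{-1}(u)=\begin{bmatrix}1&0&0&0\\0&\frac{1-u}{q-u}&\frac{u(q-1)}{q-u}&0\\0&\frac{q-1}{q-u}&\frac{q(1-u)}{q-u}&0\\0&0&0&1\end{bmatrix},$$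 $$K(u)=\frac{1}{cu^2+u-a}\begin{bmatrix}(c-a)u^2+u&c(u^2-1)\\a(u^2-1)&c-a+u\end{bmatrix},\quad \overline K(u)=\frac{1}{bu^2-u-d}\begin{bmatrix}(b-d)u^2-u&b(u^2-1)\\d(u^2-1)&b-d-u\end{bmatrix}.$$ **Fused matrices.** Define $\Pi:(\mathbb C^2)^{\otimes I}\to\mathbb C^{I+1}$ by $\Pi(e_\sigma)=e_{|\sigma|}$ and $\widehat\Pi:\mathbb C^{I+1}\to(\mathbb C^2)^{\otimes I}$ by $\widehat\Pi(e_\zeta)=Z_q(I;\zeta)^{-1}\sum_{|\sigma|=\zeta}q^{\mathrm{inv}(\sigma)}e_\sigma$. Let $X_i$ or $X_{i,j}$ denote an operator $X$ acting on the factor $i$, or on the ordered pair of factors $(i,j)$, of a tensor power of $\mathbb C^2$; let $P_{\mathrm{rev}}$ reverse the order of the $I$ factors; and let $\overrightarrow\prod$ and $\overleftarrow\prod$ be products taken from left to right in increasing and in decreasing order of the index, the inner product being performed first. Put $$R^I(u)=(\Pi\otimes\Pi)\Big(\overleftarrow{\prod_{1\le i\le I}}\ \overrightarrow{\prod_{1\le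 j\le I}}R_{j,i+I}(uq^{j-i})\Big)(\widehat\Pi\otimes\widehat\Pi)\in\mathrm{End}(\mathbb C^{I+1}\otimes\mathbb C^{I+1}),$$ $$K^I(u)=\Pi\,P_{\mathrm{rev}}\Big(\overleftarrow{\prod_{1\le i\le I}}\Big[K_i(uq^{\frac{I+1}2-i})\overleftarrow{\prod_{1\le j<i}}R_{j,i}(u^2q^{I+1-i-j})\Big]\Big)\widehat\Pi\in\mathrm{End}(\mathbb C^{I+1}),$$ $$\overline K^I(u)=\Pi\,P_{\mathrm{rev}}\Big(\overrightarrow{\prod_{1\le i\le I}}\Big[\overline K_i(uq^{\frac{I+1}2-i})\overrightarrow{\prod_{i<j\le I}}R^{-1}_{j,i}(u^2q^{I+1-i-j})\Big]\Big)\widehat\Pi\in\mathrm{End}(\mathbb C^{I+1}).$$ Let $\mathcal P_R,\mathcal P_K,\mathcal P_{\overline K}\subset\mathbb C$ be the sets of those $u$ at which the denominator ($1-qv$ for $R(v)$, $q-v$ for $R^{-1}(v)$, $cv^2+v-a$ for $K(v)$, $bv^2-v-d$ for $\overline K(v)$) of one of the unfused factors in the respective formula vanishes. **Algebra.** Let $\mathcal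 A$ be a unital associative $\mathbb C$-algebra with a representation on a complex vector space $H$, and let $\mathbf d,\mathbf e\in\mathcal A$, $\langle W|\in H^*$ and $|V\rangle\in H$ satisfy $$\mathbf d\mathbf e-q\,\mathbf e\mathbf d=1-q,\qquad\langle W|(a\mathbf e-c\mathbf d+1)=0,\qquad(b\mathbf d-d\mathbf e+1)|V\rangle=0.$$ Put $M_0(u)=u+\mathbf e$ and $M_1(u)=\frac1u+\mathbf d$, and for $u\in\mathbb C\setminus\{0\}$ and $0\le\zeta\le I$ $$M^I_\zeta(u)=\sum_{\sigma\in\{0,1\}^I,\ |\sigma|=\zeta}\ \overrightarrow{\prod_{1\le k\le I}}M_{\sigma_k}\big(uq^{-\frac{I+1}2+k}\big)\in\mathcal A.$$ **Theorem.** The vector $\mathbf M^I(u)=[M^I_0(u),\dots,M^I_I(u)]^T\in\mathbb C^{I+1}\otimes\mathcal A$ satisfies the following three relations, in which the matrices act on the components in $\mathbb C^{I+1}$ only and the factors in $\mathcal A$ are multiplied. 1. (Zamolodchikov–Faddeev relation.) For all $x,y\in\mathbb C\setminus\{0\}$ with $x/y\notin\mathcal P_R$, $$\mathbf M^I(y)\otimes\mathbf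 M^I(x)=P\,R^I(x/y)\;\mathbf M^I(x)\otimes\mathbf M^I(y),$$ where $P$ swaps the two factors of $\mathbb C^{I+1}\otimes\mathbb C^{I+1}$. 2. (First Ghoshal–Zamolodchikov relation.) $\langle W|\big(K^I(u)\mathbf M^I(1/u)-\mathbf M^I(u)\big)=0$ for all $u\in\mathbb C\setminus\{0\}$ with $u\notin\mathcal P_K$. 3. (Second Ghoshal–Zamolodchikov relation.) $\big(\overline K^I(u)\mathbf M^I(1/u)-\mathbf M^I(u)\big)|V\rangle=0$ for all $u\in\mathbb C\setminus\{0\}$ with $u\notin\mathcal P_{\overline K}$. -/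

import Mathlib

namespace FusedVertex

noncomputable section

/-! ## Unfused matrices

`ℂ²` has the basis `e₀, e₁` indexed by `Fin 2`; matrices act on column vectors, so that the entry in
row `i` and column `j` is the coefficient of `eᵢ` in the image of `eⱼ`. -/

/-- A `4 × 4` array, written in the basis `e₀⊗e₀, e₀⊗e₁, e₁⊗e₀, e₁⊗e₁`, as an operator on `ℂ² ⊗ ℂ²`. -/
def onPairs (X : Matrix (Fin 4) (Fin 4) ℂ) : Matrix (Fin 2 × Fin 2) (Fin 2 × Fin 2) ℂ :=
  Matrix.of fun i j =>
    X (finProdFinEquiv (m := 2) (n := 2) i) (finProdFinEquiv (m := 2) (n := 2) j)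

/-- The unfused `R` matrix. -/
def R (q u : ℂ) : Matrix (Fin 2 × Fin 2) (Fin 2 × Fin 2) ℂ :=
  onPairs !![1, 0, 0, 0;
             0, q * (1 - u) / (1 - q * u), u * (1 - q) / (1 - q * u), 0;
             0, (1 - q) / (1 - q * u), (1 - u) / (1 - q * u), 0;
             0, 0, 0, 1]

/-- The inverse of the unfused `R` matrix, as a rational function of `u`. -/
def Rinv (q u : ℂ) : Matrix (Fin 2 × Fin 2) (Fin 2 × Fin 2) ℂ :=
  onPairs !![1, 0, 0, 0;
             0, (1 - u) / (q - u), u * (q - 1) / (q - u), 0;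
             0, (q - 1) / (q - u), q * (1 - u) / (q - u), 0;
             0, 0, 0, 1]

/-- The unfused `K` matrix of the left boundary. -/
def K (a c u : ℂ) : Matrix (Fin 2) (Fin 2) ℂ :=
  !![((c - a) * u ^ 2 + u) / (c * u ^ 2 + u - a), c * (u ^ 2 - 1) / (c * u ^ 2 + u - a);
     a * (u ^ 2 - 1) / (c * u ^ 2 + u - a), (c - a + u) / (c * u ^ 2 + u - a)]

/-- The unfused `K` matrix of the right boundary. -/
def Kbar (b d u : ℂ) : Matrix (Fin 2) (Fin 2) ℂ :=
  !![((b - d) * u ^ 2 - u) / (b * u ^ 2 - u - d), b * (u ^ 2 - 1) / (b * u ^ 2 - u - d);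
     d * (u ^ 2 - 1) / (b * u ^ 2 - u - d), (b - d - u) / (b * u ^ 2 - u - d)]

/-- The singularities of `R`, `Rinv`, `K` and `Kbar`. -/
def singR (q : ℂ) : Set ℂ := {u | 1 - q * u = 0}
def singRinv (q : ℂ) : Set ℂ := {u | q - u = 0}
def singK (a c : ℂ) : Set ℂ := {u | c * u ^ 2 + u - a = 0}
def singKbar (b d : ℂ) : Set ℂ := {u | b * u ^ 2 - u - d = 0}

/-- `Rinv` is indeed the inverse of `R` wherever both are regular. -/
theorem R_mul_Rinv (q u : ℂ) (h : u ∉ singR q) (h' : u ∉ singRinv q) : R q u * Rinv q u = 1 := by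
  have h1 : 1 - q * u ≠ 0 := h
  have h2 : q - u ≠ 0 := h'
  ext ⟨i, j⟩ ⟨k, l⟩
  fin_cases i <;> fin_cases j <;> fin_cases k <;> fin_cases l <;>
    simp [R, Rinv, onPairs, Matrix.mul_apply, Fintype.sum_prod_type, finProdFinEquiv] <;>
    (try field_simp) <;> (try ring)

/-! ## Operators on `(ℂ²)^{⊗n}`

The basis vectors `e_{σ(0)} ⊗ ⋯ ⊗ e_{σ(n-1)}` are indexed by `σ : Fin n → Fin 2`; the factor
`k : Fin n` is the factor number `k + 1`. -/

/-- The operator `X` on `ℂ²`, acting on the factor `i`. -/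
def oneSite {n : ℕ} (X : Matrix (Fin 2) (Fin 2) ℂ) (i : Fin n) :
    Matrix (Fin n → Fin 2) (Fin n → Fin 2) ℂ :=
  Matrix.of fun σ τ => if ∀ k, k ≠ i → σ k = τ k then X (σ i) (τ i) else 0

/-- The operator `X` on `ℂ² ⊗ ℂ²`, acting on the factors `i` and `j` (for `i ≠ j`): its first
tensor factor is the factor `i`, its second tensor factor is the factor `j`. -/
def twoSite {n : ℕ} (X : Matrix (Fin 2 × Fin 2) (Fin 2 × Fin 2) ℂ) (i j : Fin n) :
    Matrix (Fin n → Fin 2) (Fin n → Fin 2) ℂ :=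
  Matrix.of fun σ τ =>
    if ∀ k, k ≠ i → k ≠ j → σ k = τ k then X (σ i, σ j) (τ i, τ j) else 0

/-- The permutation operator that reverses the order of the factors. -/
def reversal (n : ℕ) : Matrix (Fin n → Fin 2) (Fin n → Fin 2) ℂ :=
  Matrix.of fun σ τ => if σ = τ ∘ Fin.rev then 1 else 0

/-- The number of ones in a 0/1 word. -/
def weight {n : ℕ} (σ : Fin n → Fin 2) : ℕ := ∑ k, (σ k : ℕ)

/-- The number of inversions of a 0/1 word. -/
def inv {n : ℕ} (σ : Fin n → Fin 2) : ℕ :=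
  (Finset.univ.filter fun p : Fin n × Fin n => p.1 < p.2 ∧ σ p.2 < σ p.1).card

/-- `Z_q(I; ζ)`: the sum of `q ^ inv σ` over the 0/1 words `σ` of length `I` with `ζ` ones. -/
def Z (q : ℂ) (I : ℕ) (ζ : Fin (I + 1)) : ℂ :=
  ∑ σ : Fin I → Fin 2, if weight σ = ζ then q ^ inv σ else 0

/-- The surjection `Π : (ℂ²)^{⊗I} → ℂ^{I+1}`. -/
def proj (I : ℕ) : Matrix (Fin (I + 1)) (Fin I → Fin 2) ℂ :=
  Matrix.of fun ζ σ => if weight σ = ζ then 1 else 0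

/-- The injection `Π̂ : ℂ^{I+1} → (ℂ²)^{⊗I}` onto the `q`-exchangeable subspace. -/
def inj (q : ℂ) (I : ℕ) : Matrix (Fin I → Fin 2) (Fin (I + 1)) ℂ :=
  Matrix.of fun σ ζ => if weight σ = ζ then q ^ inv σ / Z q I ζ else 0

/-- The first and the last `I` letters of a word of length `I + I`. -/
def fstHalf {I : ℕ} (σ : Fin (I + I) → Fin 2) : Fin I → Fin 2 := fun k => σ (Fin.castAdd I k)
def sndHalf {I : ℕ} (σ : Fin (I + I) → Fin 2) : Fin I → Fin 2 := fun k => σ (Fin.natAdd I k)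

/-- `Π₁Π₂ : (ℂ²)^{⊗I} ⊗ (ℂ²)^{⊗I} → ℂ^{I+1} ⊗ ℂ^{I+1}`. -/
def proj₂ (I : ℕ) : Matrix (Fin (I + 1) × Fin (I + 1)) (Fin (I + I) → Fin 2) ℂ :=
  Matrix.of fun p σ => proj I p.1 (fstHalf σ) * proj I p.2 (sndHalf σ)

/-- `Π̂₁Π̂₂ : ℂ^{I+1} ⊗ ℂ^{I+1} → (ℂ²)^{⊗I} ⊗ (ℂ²)^{⊗I}`. -/
def inj₂ (q : ℂ) (I : ℕ) : Matrix (Fin (I + I) → Fin 2) (Fin (I + 1) × Fin (I + 1)) ℂ :=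
  Matrix.of fun σ p => inj q I (fstHalf σ) p.1 * inj q I (sndHalf σ) p.2

/-! ## Fusion

`q` is the bulk parameter and `r` a square root of it, so that `q ^ (m / 2) = r ^ m`. -/

/-- The index in `{1, …, I}` of a factor. -/
def idx {I : ℕ} (k : Fin I) : ℤ := (k : ℤ) + 1

/-- The product of the `f k` over the `k` with `p k`, from left to right in increasing order of `k`. -/
def prodInc {I : ℕ} {S : Type*} [Monoid S] (p : Fin I → Prop) [DecidablePred p] (f : Fin I → S) :
    S :=
  (((List.finRange I).filter (fun k => p k)).map f).prod

/-- The product of the `f k` over the `k` with `p k`, from left to right in decreasing order of `k`. -/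
def prodDec {I : ℕ} {S : Type*} [Monoid S] (p : Fin I → Prop) [DecidablePred p] (f : Fin I → S) :
    S :=
  (((List.finRange I).filter (fun k => p k)).reverse.map f).prod

/-- The fused `R` operator on `(ℂ²)^{⊗I} ⊗ (ℂ²)^{⊗I}`. -/
def fusedROp (q : ℂ) (I : ℕ) (u : ℂ) :
    Matrix (Fin (I + I) → Fin 2) (Fin (I + I) → Fin 2) ℂ :=
  prodDec (fun _ : Fin I => True) fun a =>
    prodInc (fun _ : Fin I => True) fun b =>
      twoSite (R q (u * q ^ (idx b - idx a))) (Fin.castAdd I b) (Fin.natAdd I a)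

/-- The fused `K` operator on `(ℂ²)^{⊗I}`. -/
def fusedKOp (q r a c : ℂ) (I : ℕ) (u : ℂ) : Matrix (Fin I → Fin 2) (Fin I → Fin 2) ℂ :=
  reversal I *
    prodDec (fun _ : Fin I => True) fun i =>
      oneSite (K a c (u * r ^ ((I : ℤ) + 1 - 2 * idx i))) i *
        prodDec (fun j : Fin I => j < i) fun j =>
          twoSite (R q (u ^ 2 * q ^ ((I : ℤ) + 1 - idx i - idx j))) j i

/-- The fused `K̄` operator on `(ℂ²)^{⊗I}`. -/
def fusedKbarOp (q r b d : ℂ) (I : ℕ) (u : ℂ) : Matrix (Fin I → Fin 2) (Fin I → Fin 2) ℂ :=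
  reversal I *
    prodInc (fun _ : Fin I => True) fun i =>
      oneSite (Kbar b d (u * r ^ ((I : ℤ) + 1 - 2 * idx i))) i *
        prodInc (fun j : Fin I => i < j) fun j =>
          twoSite (Rinv q (u ^ 2 * q ^ ((I : ℤ) + 1 - idx i - idx j))) j i

/-- The fused matrices `R^I(u)`, `K^I(u)` and `K̄^I(u)`. -/
def fusedR (q : ℂ) (I : ℕ) (u : ℂ) :
    Matrix (Fin (I + 1) × Fin (I + 1)) (Fin (I + 1) × Fin (I + 1)) ℂ :=
  proj₂ I * fusedROp q I u * inj₂ q I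

def fusedK (q r a c : ℂ) (I : ℕ) (u : ℂ) : Matrix (Fin (I + 1)) (Fin (I + 1)) ℂ :=
  proj I * fusedKOp q r a c I u * inj q I

def fusedKbar (q r b d : ℂ) (I : ℕ) (u : ℂ) : Matrix (Fin (I + 1)) (Fin (I + 1)) ℂ :=
  proj I * fusedKbarOp q r b d I u * inj q I

/-- The singularities of the fused matrices: the points where one of the unfused matrices in their
definition is singular. -/
def singFusedR (q : ℂ) (I : ℕ) : Set ℂ :=
  {u | ∃ a b : Fin I, u * q ^ (idx b - idx a) ∈ singR q}

def singFusedK (q r a c : ℂ) (I : ℕ) : Set ℂ :=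
  {u | (∃ i : Fin I, u * r ^ ((I : ℤ) + 1 - 2 * idx i) ∈ singK a c) ∨
    ∃ i j : Fin I, j < i ∧ u ^ 2 * q ^ ((I : ℤ) + 1 - idx i - idx j) ∈ singR q}

def singFusedKbar (q r b d : ℂ) (I : ℕ) : Set ℂ :=
  {u | (∃ i : Fin I, u * r ^ ((I : ℤ) + 1 - 2 * idx i) ∈ singKbar b d) ∨
    ∃ i j : Fin I, i < j ∧ u ^ 2 * q ^ ((I : ℤ) + 1 - idx i - idx j) ∈ singRinv q}

/-! ## The Zamolodchikov–Faddeev and Ghoshal–Zamolodchikov relations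

An element of `𝔙 ⊗ 𝒜`, where `𝔙` has a basis indexed by `ι`, is the family `ι → 𝒜` of its
coordinates. -/

section Relations

variable {ι : Type*} [Fintype ι] [DecidableEq ι] {A : Type*} [Ring A] [Algebra ℂ A]
  {H : Type*} [AddCommGroup H] [Module ℂ H]

/-- The operator `P` that swaps the two factors of `𝔙 ⊗ 𝔙`. -/
def swapOp (ι : Type*) [DecidableEq ι] : Matrix (ι × ι) (ι × ι) ℂ :=
  Matrix.of fun i j => if i = j.swap then 1 else 0

/-- `m ⊗ m'`, with the two factors in `𝒜` multiplied. -/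
def tensor (m m' : ι → A) : ι × ι → A := fun p => m p.1 * m' p.2

/-- A complex matrix acting on the component `𝔙` of `𝔙 ⊗ 𝒜`. -/
def act (X : Matrix ι ι ℂ) (m : ι → A) : ι → A := fun i => ∑ j, X i j • m j

/-- The ZF relation `M(y) ⊗ M(x) = Ř(x/y) M(x) ⊗ M(y)`, where `Ř = P R`. -/
def ZFRelation (Rm : ℂ → Matrix (ι × ι) (ι × ι) ℂ) (sing : Set ℂ) (M : ℂ → ι → A) : Prop :=
  ∀ x y : ℂ, x ≠ 0 → y ≠ 0 → x / y ∉ sing →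
    tensor (M y) (M x) = act (swapOp ι * Rm (x / y)) (tensor (M x) (M y))

/-- The first GZ relation `⟨W| (K(u) M(1/u) - M(u)) = 0`. -/
def FirstGZRelation (Km : ℂ → Matrix ι ι ℂ) (sing : Set ℂ) (ρ : A →ₐ[ℂ] Module.End ℂ H)
    (W : Module.Dual ℂ H) (M : ℂ → ι → A) : Prop :=
  ∀ u : ℂ, u ≠ 0 → u ∉ sing → ∀ i, W ∘ₗ ρ (act (Km u) (M (1 / u)) i - M u i) = 0

/-- The second GZ relation `(K̄(u) M(1/u) - M(u)) |V⟩ = 0`. -/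
def SecondGZRelation (Km : ℂ → Matrix ι ι ℂ) (sing : Set ℂ) (ρ : A →ₐ[ℂ] Module.End ℂ H)
    (V : H) (M : ℂ → ι → A) : Prop :=
  ∀ u : ℂ, u ≠ 0 → u ∉ sing → ∀ i, ρ (act (Km u) (M (1 / u)) i - M u i) V = 0

end Relations

/-! ## The solutions -/

section Solutions

variable {A : Type*} [Ring A] [Algebra ℂ A]

/-- `M₀(u) = u + e` and `M₁(u) = 1/u + d`. -/
def M (d e : A) (u : ℂ) : Fin 2 → A :=
  ![algebraMap ℂ A u + e, algebraMap ℂ A (1 / u) + d]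

/-- `M^I_ζ(u)`: the sum over the 0/1 words `σ` of length `I` with `ζ` ones of the products, from left
to right in increasing order of `k`, of the `M_{σ(k)}(u q^{-(I+1)/2+k})`. -/
def fusedM (r : ℂ) (d e : A) (I : ℕ) (u : ℂ) : Fin (I + 1) → A := fun ζ =>
  ∑ σ : Fin I → Fin 2, if weight σ = ζ then
    prodInc (fun _ : Fin I => True) fun k => M d e (u * r ^ (-((I : ℤ) + 1) + 2 * idx k)) (σ k)
  else 0

end Solutions

end

end FusedVertex

/-! Write `M^I(u)` as `Π T(u)`, where `T(u) = unfusedM` has as coordinates the words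
`M_{σ₁}(p₁)⋯M_{σ_I}(p_I)`, with `p_{k+1} = q p_k`. For parameters `v, qv` the algebra relation gives
`M₁M₀ = q M₀M₁`, so the coordinate at `σ` is `q^{inv σ}` times an element depending only on `|σ|`
(`geomWord_eq`). Hence `Π̂ Π T = T` (`rectAct_inj_fusedM`): a fused matrix acting on `M^I` is `Π`
applied to the product of unfused operators acting on `T`.

That product is followed letter by letter. Each letter keeps its tensor factor when its place in the
word changes, so an unfused `R` or `R⁻¹` exchanges two neighbouring letters without a swap, and `K`
or `K̄` inverts the parameter of the letter at the left or right end. For ZF, the `y`-word crosses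
the `x`-word (`prod_prod_twoSite_R_word`). For GZ, every letter is carried to the boundary and
reflected (`prod_K_R_word`, `prod_Kbar_Rinv_word`), which leaves the word in reverse order; `P_rev`
restores `T(u)`. The GZ identities hold modulo a submodule `N` of `A`: the elements killed by `⟨W|`,
stable under right multiplication, or those killed by `|V⟩`, stable under left multiplication. -/

namespace FusedVertex

/-! ### Complex matrices acting on `A`-valued vectors, and the case of one or two letters. -/

section Actions

variable {A : Type*} [Ring A] [Algebra ℂ A]

/-- A rectangular complex matrix acting on the first component of `𝔙 ⊗ 𝒜`. -/
def rectAct {ι κ : Type*} [Fintype κ] (X : Matrix ι κ ℂ) (m : κ → A) : ι → A :=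
  fun i => ∑ j, X i j • m j

theorem act_eq_rectAct {ι : Type*} [Fintype ι] (X : Matrix ι ι ℂ) (m : ι → A) :
    act X m = rectAct X m := rfl

theorem rectAct_mul {ι κ l : Type*} [Fintype κ] [Fintype l] (X : Matrix ι κ ℂ) (Y : Matrix κ l ℂ)
    (m : l → A) : rectAct (X * Y) m = rectAct X (rectAct Y m) := by
  funext i
  simp only [rectAct, Matrix.mul_apply, Finset.sum_smul, Finset.smul_sum, mul_smul]
  exact Finset.sum_comm

theorem rectAct_one {ι : Type*} [Fintype ι] [DecidableEq ι] (m : ι → A) :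
    rectAct (1 : Matrix ι ι ℂ) m = m := by
  funext i
  simp [rectAct, Matrix.one_apply]

/-- Matrix entries are scalars, so any further operator may be applied to a congruence modulo `N`.
-/
theorem rectAct_sub_mem {ι κ : Type*} [Fintype κ] (N : Submodule ℂ A) (X : Matrix ι κ ℂ)
    {m m' : κ → A} (h : ∀ k, m k - m' k ∈ N) (i : ι) : rectAct X m i - rectAct X m' i ∈ N := by
  simp only [rectAct, ← Finset.sum_sub_distrib, ← smul_sub]
  exact N.sum_mem fun k _ => N.smul_mem _ (h k)

theorem rectAct_oneSite {n : ℕ} (X : Matrix (Fin 2) (Fin 2) ℂ) (i : Fin n)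
    (m : (Fin n → Fin 2) → A) (σ : Fin n → Fin 2) :
    rectAct (oneSite X i) m σ = ∑ s, X (σ i) s • m (Function.update σ i s) := by
  symm
  apply Fintype.sum_of_injective (fun s => Function.update σ i s) (Function.update_injective σ i)
  · intro τ hτ
    rw [oneSite, Matrix.of_apply, if_neg, zero_smul]
    intro h
    refine hτ ⟨τ i, ?_⟩
    funext k
    by_cases hk : k = i
    · subst hk
      simp
    · simp [hk, h k hk]
  · intro s
    rw [oneSite, Matrix.of_apply, if_pos]
    · simp
    · intro k hk
      simp [hk]

theorem rectAct_twoSite {n : ℕ} (X : Matrix (Fin 2 × Fin 2) (Fin 2 × Fin 2) ℂ) {i j : Fin n}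
    (hij : i ≠ j) (m : (Fin n → Fin 2) → A) (σ : Fin n → Fin 2) :
    rectAct (twoSite X i j) m σ =
      ∑ s : Fin 2 × Fin 2, X (σ i, σ j) s •
        m (Function.update (Function.update σ i s.1) j s.2) := by
  symm
  apply Fintype.sum_of_injective
    (fun s : Fin 2 × Fin 2 => Function.update (Function.update σ i s.1) j s.2)
  · rintro ⟨s, t⟩ ⟨s', t'⟩ h
    have h1 := congrFun h i
    have h2 := congrFun h j
    simp [hij] at h1 h2
    simp [h1, h2]
  · intro τ hτ
    rw [twoSite, Matrix.of_apply, if_neg, zero_smul]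
    intro h
    refine hτ ⟨(τ i, τ j), ?_⟩
    funext k
    by_cases hk : k = j
    · subst hk; simp
    by_cases hk' : k = i
    · subst hk'; simp [hk]
    · simp [hk, hk', h k hk' hk]
  · rintro ⟨s, t⟩
    rw [twoSite, Matrix.of_apply, if_pos]
    · simp [hij]
    · intro k hk hk'
      simp [hk, hk']

/-- The product of the `M_{σ(k)}(x)` over the pairs `(k, x)` in a list, from left to right. -/
noncomputable def word {n : ℕ} (D E : A) (l : List (Fin n × ℂ)) (σ : Fin n → Fin 2) : A :=
  (l.map fun s => M D E s.2 (σ s.1)).prod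

theorem word_append {n : ℕ} (D E : A) (l l' : List (Fin n × ℂ)) (σ : Fin n → Fin 2) :
    word D E (l ++ l') σ = word D E l σ * word D E l' σ := by
  simp [word]

theorem word_cons {n : ℕ} (D E : A) (s : Fin n × ℂ) (l : List (Fin n × ℂ)) (σ : Fin n → Fin 2) :
    word D E (s :: l) σ = M D E s.2 (σ s.1) * word D E l σ := by
  simp [word]

theorem word_nil {n : ℕ} (D E : A) (σ : Fin n → Fin 2) : word D E [] σ = 1 := rfl

theorem word_update {n : ℕ} (D E : A) {l : List (Fin n × ℂ)} {i : Fin n} (h : i ∉ l.map Prod.fst)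
    (σ : Fin n → Fin 2) (s : Fin 2) : word D E l (Function.update σ i s) = word D E l σ := by
  unfold word
  congr 1
  apply List.map_congr_left
  intro t ht
  rw [Function.update_of_ne]
  rintro rfl
  exact h (List.mem_map_of_mem ht)

/-! ### The relations of the unfused matrices -/

/-- The ratio `v / (q v) = 1/q` is the pole of `R`; this is what the exchange relation becomes there
after its denominator is cleared. It is the source of `q`-exchangeability. -/
theorem M_one_mul_M_zero {q : ℂ} (hq : q ≠ 0) {D E : A}
    (hDE : D * E - q • (E * D) = algebraMap ℂ A (1 - q)) {v : ℂ} (hv : v ≠ 0) :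
    M D E v 1 * M D E (q * v) 0 = q • (M D E v 0 * M D E (q * v) 1) := by
  have h : D * E = q • (E * D) + (1 - q) • (1 : A) := by
    rw [← Algebra.algebraMap_eq_smul_one, ← hDE]; abel
  simp only [M, Matrix.cons_val_zero, Matrix.cons_val_one, Algebra.algebraMap_eq_smul_one,
    mul_add, add_mul, smul_mul_assoc, mul_smul_comm, one_mul, mul_one, h, smul_add, smul_smul]
  match_scalars <;> field_simp <;> ring

theorem R_mul_M {q : ℂ} {D E : A} (hDE : D * E - q • (E * D) = algebraMap ℂ A (1 - q))
    {x y : ℂ} (hx : x ≠ 0) (hy : y ≠ 0) (h : x / y ∉ singR q) (s t : Fin 2) :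
    ∑ p : Fin 2 × Fin 2, R q (x / y) (s, t) p • (M D E x p.1 * M D E y p.2) =
      M D E y t * M D E x s := by
  have hDE' : D * E = q • (E * D) + (1 - q) • (1 : A) := by
    rw [← Algebra.algebraMap_eq_smul_one, ← hDE]; abel
  have h1 : 1 - q * (x / y) ≠ 0 := h
  have h2 : y - q * x ≠ 0 := by
    intro h0; apply h1; field_simp; linear_combination h0
  fin_cases s <;> fin_cases t <;>
    simp [M, R, onPairs, finProdFinEquiv, Fintype.sum_prod_type, Algebra.algebraMap_eq_smul_one,
      mul_add, add_mul, hDE', smul_smul] <;>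
    match_scalars <;> field_simp <;> ring

theorem Rinv_mul_M {q : ℂ} {D E : A} (hDE : D * E - q • (E * D) = algebraMap ℂ A (1 - q))
    {x y : ℂ} (hx : x ≠ 0) (hy : y ≠ 0) (h : x / y ∉ singRinv q) (s t : Fin 2) :
    ∑ p : Fin 2 × Fin 2, Rinv q (x / y) (s, t) p • (M D E y p.2 * M D E x p.1) =
      M D E x s * M D E y t := by
  have hDE' : D * E = q • (E * D) + (1 - q) • (1 : A) := by
    rw [← Algebra.algebraMap_eq_smul_one, ← hDE]; abel
  have h1 : q - x / y ≠ 0 := h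
  obtain ⟨z, rfl⟩ : ∃ z, x = z * y := ⟨x / y, by field_simp⟩
  rw [mul_div_assoc, div_self hy, mul_one] at h1 ⊢
  have hz : z ≠ 0 := left_ne_zero_of_mul hx
  fin_cases s <;> fin_cases t <;>
    simp [M, Rinv, onPairs, finProdFinEquiv, Fintype.sum_prod_type,
      Algebra.algebraMap_eq_smul_one, mul_add, add_mul, hDE', smul_smul] <;>
    match_scalars <;> grind

theorem K_mul_M {a c : ℂ} (D E : A) {u : ℂ} (hu : u ≠ 0) (h : u ∉ singK a c) (s : Fin 2) :
    ∃ z : ℂ, ∑ t, K a c u s t • M D E (1 / u) t - M D E u s = z • (a • E - c • D + 1) := by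
  have h1 : c * u ^ 2 + u - a ≠ 0 := h
  unfold K
  -- The denominator becomes an atom; `a` enters it with coefficient `-1` and is eliminated without
  -- division.
  generalize hδ : c * u ^ 2 + u - a = δ at h1
  obtain rfl : a = c * u ^ 2 + u - δ := by rw [← hδ]; ring
  refine ⟨![-(u ^ 2 - 1) / δ, (u ^ 2 - 1) / δ] s, ?_⟩
  fin_cases s <;>
    simp [M, Algebra.algebraMap_eq_smul_one, smul_smul, smul_sub, smul_add] <;>
    match_scalars <;> field_simp <;> ring

theorem Kbar_mul_M {b d : ℂ} (D E : A) {u : ℂ} (hu : u ≠ 0) (h : u ∉ singKbar b d) (s : Fin 2) :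
    ∃ z : ℂ, ∑ t, Kbar b d u s t • M D E (1 / u) t - M D E u s = z • (b • D - d • E + 1) := by
  have h1 : b * u ^ 2 - u - d ≠ 0 := h
  unfold Kbar
  generalize hδ : b * u ^ 2 - u - d = δ at h1
  obtain rfl : d = b * u ^ 2 - u - δ := by rw [← hδ]; ring
  refine ⟨![(u ^ 2 - 1) / δ, -(u ^ 2 - 1) / δ] s, ?_⟩
  fin_cases s <;>
    simp [M, Algebra.algebraMap_eq_smul_one, smul_smul, smul_sub, smul_add] <;>
    match_scalars <;> field_simp <;> ring

end Actions

/-! ### Transport of whole words by products of unfused operators. -/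

section Words

variable {A : Type*} [Ring A] [Algebra ℂ A]

/-! ### Exchanging letters -/

theorem twoSite_R_word {n : ℕ} {q : ℂ} {D E : A}
    (hDE : D * E - q • (E * D) = algebraMap ℂ A (1 - q)) {x y : ℂ} (hx : x ≠ 0) (hy : y ≠ 0)
    (h : x / y ∉ singR q) {i j : Fin n} {l l' : List (Fin n × ℂ)}
    (hl : ((l ++ (i, x) :: (j, y) :: l').map Prod.fst).Nodup) :
    rectAct (twoSite (R q (x / y)) i j) (word D E (l ++ (i, x) :: (j, y) :: l')) =
      word D E (l ++ (j, y) :: (i, x) :: l') := by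
  simp only [List.map_append, List.map_cons, List.nodup_append, List.nodup_cons,
    List.mem_cons, not_or] at hl
  obtain ⟨-, ⟨⟨hij, hi⟩, hj, -⟩, hd⟩ := hl
  have hi' : i ∉ l.map Prod.fst := fun hm => hd i hm i (by simp) rfl
  have hj' : j ∉ l.map Prod.fst := fun hm => hd j hm j (by simp) rfl
  funext σ
  rw [rectAct_twoSite _ hij]
  simp only [word_append, word_cons, word_update D E hi, word_update D E hj, word_update D E hi',
    word_update D E hj', Function.update_self, Function.update_of_ne hij]
  rw [← mul_assoc (M D E y (σ j)), ← R_mul_M hDE hx hy h (σ i) (σ j), Finset.sum_mul]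
  simp only [Finset.mul_sum, smul_mul_assoc, mul_smul_comm, mul_assoc]

theorem twoSite_Rinv_word {n : ℕ} {q : ℂ} {D E : A}
    (hDE : D * E - q • (E * D) = algebraMap ℂ A (1 - q)) {x y : ℂ} (hx : x ≠ 0) (hy : y ≠ 0)
    (h : x / y ∉ singRinv q) {i j : Fin n} {l l' : List (Fin n × ℂ)}
    (hl : ((l ++ (j, y) :: (i, x) :: l').map Prod.fst).Nodup) :
    rectAct (twoSite (Rinv q (x / y)) i j) (word D E (l ++ (j, y) :: (i, x) :: l')) =
      word D E (l ++ (i, x) :: (j, y) :: l') := by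
  simp only [List.map_append, List.map_cons, List.nodup_append, List.nodup_cons,
    List.mem_cons, not_or] at hl
  obtain ⟨-, ⟨⟨hji, hj⟩, hi, -⟩, hd⟩ := hl
  have hij := Ne.symm hji
  have hi' : i ∉ l.map Prod.fst := fun hm => hd i hm i (by simp) rfl
  have hj' : j ∉ l.map Prod.fst := fun hm => hd j hm j (by simp) rfl
  funext σ
  rw [rectAct_twoSite _ hij]
  simp only [word_append, word_cons, word_update D E hi, word_update D E hj, word_update D E hi',
    word_update D E hj', Function.update_self, Function.update_of_ne hij]
  rw [← mul_assoc (M D E x (σ i)), ← Rinv_mul_M hDE hx hy h (σ i) (σ j), Finset.sum_mul]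
  simp only [Finset.mul_sum, smul_mul_assoc, mul_smul_comm, mul_assoc]

/-- Moving the letter `(j, y)` to the left through all letters of `m`. -/
theorem prod_twoSite_R_word {n : ℕ} {q : ℂ} {D E : A}
    (hDE : D * E - q • (E * D) = algebraMap ℂ A (1 - q)) {j : Fin n} {y : ℂ} (hy : y ≠ 0)
    (l m l' : List (Fin n × ℂ)) (hm : ∀ s ∈ m, s.2 ≠ 0 ∧ s.2 / y ∉ singR q)
    (hl : ((l ++ m ++ (j, y) :: l').map Prod.fst).Nodup) :
    rectAct (m.map fun s => twoSite (R q (s.2 / y)) s.1 j).prod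
      (word D E (l ++ m ++ (j, y) :: l')) = word D E (l ++ (j, y) :: (m ++ l')) := by
  induction m generalizing l with
  | nil => simp [rectAct_one]
  | cons s m ih =>
    rw [List.map_cons, List.prod_cons, rectAct_mul]
    -- The operator of `s` is leftmost and acts last: the moving letter first passes the rest of
    -- `m`, with `s` counted in the fixed prefix.
    have h1 := ih (l ++ [s]) (fun t ht => hm t (List.mem_cons_of_mem _ ht)) (by simpa using hl)
    simp only [List.append_assoc, List.nil_append, List.cons_append] at h1 ⊢
    rw [h1]
    refine twoSite_R_word hDE (hm s (by simp)).1 hy (hm s (by simp)).2 (l := l) ?_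
    refine (List.Perm.nodup_iff (List.Perm.map _ ?_)).mp hl
    rw [List.append_assoc]
    refine List.Perm.append_left l ?_
    exact (List.Perm.cons s List.perm_middle)

/-- Moving the letter `(j, y)` to the right through all letters of `m`, which stand in front of it
after the move. -/
theorem prod_twoSite_Rinv_word {n : ℕ} {q : ℂ} {D E : A}
    (hDE : D * E - q • (E * D) = algebraMap ℂ A (1 - q)) {j : Fin n} {y : ℂ} (hy : y ≠ 0)
    (l m l' : List (Fin n × ℂ)) (hm : ∀ s ∈ m, s.2 ≠ 0 ∧ s.2 / y ∉ singRinv q)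
    (hl : ((l ++ (j, y) :: (m ++ l')).map Prod.fst).Nodup) :
    rectAct (m.reverse.map fun s => twoSite (Rinv q (s.2 / y)) s.1 j).prod
      (word D E (l ++ (j, y) :: (m ++ l'))) = word D E (l ++ m ++ (j, y) :: l') := by
  -- The last letter of `m` is the last one crossed, so `m` is peeled from its end.
  induction m using List.reverseRecOn generalizing l' with
  | nil => simp [rectAct_one]
  | append_singleton m s ih =>
    rw [List.reverse_append, List.reverse_singleton, List.singleton_append, List.map_cons,
      List.prod_cons, rectAct_mul]
    have h1 := ih (s :: l') (fun t ht => hm t (List.mem_append_left _ ht)) (by simpa using hl)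
    simp only [List.append_assoc, List.singleton_append] at h1 ⊢
    rw [h1, ← List.append_assoc, ← List.append_assoc]
    refine twoSite_Rinv_word hDE (hm s (by simp)).1 hy (hm s (by simp)).2 (l := l ++ m) ?_
    refine (List.Perm.nodup_iff (List.Perm.map _ ?_)).mp hl
    simp only [List.append_assoc, List.singleton_append]
    exact List.Perm.append_left l List.perm_middle.symm

/-- Moving the word `xs` to the left through the word `m`. -/
theorem prod_prod_twoSite_R_word {n : ℕ} {q : ℂ} {D E : A}
    (hDE : D * E - q • (E * D) = algebraMap ℂ A (1 - q))
    (l m xs : List (Fin n × ℂ)) (hm : ∀ s ∈ m, s.2 ≠ 0) (hx : ∀ t ∈ xs, t.2 ≠ 0)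
    (hR : ∀ s ∈ m, ∀ t ∈ xs, s.2 / t.2 ∉ singR q)
    (hl : ((l ++ m ++ xs).map Prod.fst).Nodup) :
    rectAct (xs.reverse.map fun t => (m.map fun s => twoSite (R q (s.2 / t.2)) s.1 t.1).prod).prod
      (word D E (l ++ m ++ xs)) = word D E (l ++ xs ++ m) := by
  induction xs generalizing l with
  | nil => simp [rectAct_one]
  | cons t xs ih =>
    rw [List.reverse_cons, List.map_append, List.prod_append, rectAct_mul, List.map_singleton,
      List.prod_singleton, prod_twoSite_R_word hDE (hx t (by simp)) l m xs
        (fun s hs => ⟨hm s hs, hR s hs t (by simp)⟩) hl]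
    have h1 := ih (l ++ [t]) (fun s hs => hx s (by simp [hs]))
      (fun s hs s' hs' => hR s hs s' (by simp [hs'])) (by
        refine (List.Perm.nodup_iff (List.Perm.map _ ?_)).mp hl
        simp only [List.append_assoc, List.singleton_append]
        exact List.Perm.append_left l List.perm_middle)
    simpa using h1

/-! ### Reflecting letters at the boundary -/

/-- The defect of reflecting one letter is a multiple of the boundary element. The remaining letters
multiply it from the right, which preserves `N`; this is why the reflected letter must stand first.
-/
theorem oneSite_K_word {n : ℕ} {a c : ℂ} {D E : A} (N : Submodule ℂ A)
    (hN : ∀ x ∈ N, ∀ y, x * y ∈ N) (hK : a • E - c • D + 1 ∈ N) {u : ℂ} (hu : u ≠ 0)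
    (h : u ∉ singK a c) {i : Fin n} {l : List (Fin n × ℂ)}
    (hl : i ∉ l.map Prod.fst) (σ : Fin n → Fin 2) :
    rectAct (oneSite (K a c u) i) (word D E ((i, 1 / u) :: l)) σ - word D E ((i, u) :: l) σ ∈ N := by
  rw [rectAct_oneSite]
  simp only [word_cons, word_update D E hl, Function.update_self, ← smul_mul_assoc,
    ← Finset.sum_mul, ← sub_mul]
  obtain ⟨z, hz⟩ := K_mul_M D E hu h (σ i)
  rw [hz]
  exact hN _ (N.smul_mem _ hK) _

theorem oneSite_Kbar_word {n : ℕ} {b d : ℂ} {D E : A} (N : Submodule ℂ A)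
    (hN : ∀ x ∈ N, ∀ y, y * x ∈ N) (hK : b • D - d • E + 1 ∈ N) {u : ℂ} (hu : u ≠ 0)
    (h : u ∉ singKbar b d) {i : Fin n} {l : List (Fin n × ℂ)}
    (hl : i ∉ l.map Prod.fst) (σ : Fin n → Fin 2) :
    rectAct (oneSite (Kbar b d u) i) (word D E (l ++ [(i, 1 / u)])) σ -
      word D E (l ++ [(i, u)]) σ ∈ N := by
  rw [rectAct_oneSite]
  simp only [word_append, word_cons, word_nil, mul_one, word_update D E hl, Function.update_self,
    ← mul_smul_comm, ← Finset.mul_sum, ← mul_sub]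
  obtain ⟨z, hz⟩ := Kbar_mul_M D E hu h (σ i)
  rw [hz]
  exact hN _ (N.smul_mem _ hK) _

/-- The letters `L`, with parameters `1 / p`, are one after the other moved to the left end and
reflected. -/
theorem prod_K_R_word {n : ℕ} {q a c : ℂ} {D E : A}
    (hDE : D * E - q • (E * D) = algebraMap ℂ A (1 - q)) (N : Submodule ℂ A)
    (hN : ∀ x ∈ N, ∀ y, x * y ∈ N) (hK : a • E - c • D + 1 ∈ N) (p : Fin n → ℂ)
    (f : Fin n → Matrix (Fin n → Fin 2) (Fin n → Fin 2) ℂ) (L : List (Fin n)) (hL : L.Nodup)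
    (hp : ∀ i ∈ L, p i ≠ 0 ∧ p i ∉ singK a c)
    (hf : ∀ l i l', L = l ++ i :: l' → (∀ j ∈ l, p j * p i ∉ singR q) ∧
      f i = oneSite (K a c (p i)) i *
        (l.reverse.map fun j => twoSite (R q (p j * p i)) j i).prod)
    (l l' : List (Fin n)) (hll : L = l ++ l') (σ : Fin n → Fin 2) :
    rectAct (l.reverse.map f).prod (word D E (L.map fun k => (k, 1 / p k))) σ -
      word D E ((l.reverse.map fun k => (k, p k)) ++ l'.map fun k => (k, 1 / p k)) σ ∈ N := by
  induction l using List.reverseRecOn generalizing l' σ with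
  | nil =>
    subst hll
    simp [rectAct_one]
  | append_singleton l i ih =>
    have hll' : L = l ++ i :: l' := by simpa using hll
    obtain ⟨h1, h2⟩ := hf l i l' hll'
    have hi := hp i (by simp [hll'])
    rw [List.reverse_append, List.reverse_singleton, List.singleton_append, List.map_cons,
      List.prod_cons, rectAct_mul]
    -- The intermediate vector is `f i` applied to the word in which the letters of `l` are already
    -- reflected.
    rw [← sub_add_sub_cancel]
    refine N.add_mem (rectAct_sub_mem N _ (fun τ => ih (i :: l') hll' τ) σ) ?_
    have hnd : ((l.reverse ++ i :: l')).Nodup := by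
      rw [hll'] at hL
      exact (List.Perm.nodup_iff (List.Perm.append_right _ (List.reverse_perm l))).mpr hL
    have hnd' : (i :: (l.reverse ++ l')).Nodup := (List.Perm.nodup_iff List.perm_middle).mp hnd
    -- An unreflected letter `1 / p i` crosses reflected letters `p j`; the ratio of parameters is
    -- `p j * p i`, hence the `u²` in the fused `K`.
    have h3 := prod_twoSite_R_word hDE (j := i) (y := 1 / p i) (one_div_ne_zero hi.1) []
      (l.reverse.map fun k => (k, p k)) (l'.map fun k => (k, 1 / p k)) (by
        intro s hs
        simp only [List.mem_map, List.mem_reverse] at hs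
        obtain ⟨j, hj, rfl⟩ := hs
        refine ⟨(hp j (by simp [hll', hj])).1, ?_⟩
        simpa using h1 j hj) (by simpa [Function.comp_def] using hnd)
    simp only [List.map_map, Function.comp_def, List.nil_append, div_div_eq_mul_div, div_one] at h3
    rw [h2, rectAct_mul, List.map_cons, h3, List.map_cons, List.cons_append]
    refine oneSite_K_word N hN hK hi.1 hi.2 ?_ σ
    simpa [Function.comp_def] using (List.nodup_cons.mp hnd').1

/-- The letters `L`, with parameters `1 / p`, are one after the other reflected at the right end,
after which the letters to their right are moved back. -/
theorem prod_Kbar_Rinv_word {n : ℕ} {q b d : ℂ} {D E : A}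
    (hDE : D * E - q • (E * D) = algebraMap ℂ A (1 - q)) (N : Submodule ℂ A)
    (hN : ∀ x ∈ N, ∀ y, y * x ∈ N) (hK : b • D - d • E + 1 ∈ N) (p : Fin n → ℂ)
    (f : Fin n → Matrix (Fin n → Fin 2) (Fin n → Fin 2) ℂ) (L : List (Fin n)) (hL : L.Nodup)
    (hp : ∀ i ∈ L, p i ≠ 0 ∧ p i ∉ singKbar b d)
    (hf : ∀ l i l', L = l ++ i :: l' → (∀ j ∈ l', p j * p i ∉ singRinv q) ∧
      f i = oneSite (Kbar b d (p i)) i *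
        (l'.map fun j => twoSite (Rinv q (p j * p i)) j i).prod)
    (l l' : List (Fin n)) (hll : L = l ++ l') (σ : Fin n → Fin 2) :
    rectAct (l'.map f).prod (word D E (L.map fun k => (k, 1 / p k))) σ -
      word D E ((l.map fun k => (k, 1 / p k)) ++ l'.reverse.map fun k => (k, p k)) σ ∈ N := by
  induction l' generalizing l σ with
  | nil =>
    subst hll
    simp [rectAct_one]
  | cons i l' ih =>
    obtain ⟨h1, h2⟩ := hf l i l' hll
    have hi := hp i (by simp [hll])
    rw [List.map_cons, List.prod_cons, rectAct_mul, ← sub_add_sub_cancel]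
    refine N.add_mem (rectAct_sub_mem N _ (fun τ => ih (l ++ [i]) (by simpa using hll) τ) σ) ?_
    have hnd : ((l ++ i :: l'.reverse)).Nodup := by
      rw [hll] at hL
      exact (List.Perm.nodup_iff (List.Perm.append_left _
        (List.Perm.cons _ (List.reverse_perm l')))).mpr hL
    have hnd' : (i :: (l ++ l'.reverse)).Nodup := (List.Perm.nodup_iff List.perm_middle).mp hnd
    -- `R⁻¹` acts before `K̄`: the letter `i` passes the already reflected letters and only then
    -- stands at the right end.
    have h3 := prod_twoSite_Rinv_word hDE (j := i) (y := 1 / p i) (one_div_ne_zero hi.1)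
      (l.map fun k => (k, 1 / p k)) (l'.reverse.map fun k => (k, p k)) [] (by
        intro s hs
        simp only [List.mem_map, List.mem_reverse] at hs
        obtain ⟨j, hj, rfl⟩ := hs
        refine ⟨(hp j (by simp [hll, hj])).1, ?_⟩
        simpa using h1 j hj) (by simpa [Function.comp_def] using hnd)
    simp only [← List.map_reverse, List.reverse_reverse, List.map_map, Function.comp_def,
      List.append_nil, div_div_eq_mul_div, div_one] at h3
    rw [h2, rectAct_mul, List.map_append, List.map_singleton, List.append_assoc,
      List.singleton_append, h3, List.reverse_cons, List.map_append, List.map_singleton,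
      ← List.append_assoc]
    refine oneSite_Kbar_word N hN hK hi.1 hi.2 ?_ σ
    simpa [Function.comp_def] using (List.nodup_cons.mp hnd').1

end Words

/-! ### `q`-exchangeability of the unfused vector, and recovering it from its projection. -/

section Exchangeability

variable {A : Type*} [Ring A] [Algebra ℂ A]

/-! ### `q`-exchangeability -/

/-- The product of the `M_{σ(k)}(q^k v)`, from left to right. -/
noncomputable def geomWord (q : ℂ) (D E : A) (n : ℕ) (v : ℂ) (σ : Fin n → Fin 2) : A :=
  ((List.finRange n).map fun k : Fin n => M D E (q ^ (k : ℕ) * v) (σ k)).prod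

theorem geomWord_cons (q : ℂ) (D E : A) (n : ℕ) (v : ℂ) (s : Fin 2) (σ : Fin n → Fin 2) :
    geomWord q D E (n + 1) v (Fin.cons s σ) = M D E v s * geomWord q D E n (q * v) σ := by
  simp [geomWord, List.finRange_succ, Function.comp_def, pow_succ, mul_assoc]

/-- The product of the `M_{σ(k)}(q^k v)` for the word `σ = 0⋯01⋯1` with `z` zeros and `o` ones. -/
noncomputable def sortedWord (q : ℂ) (D E : A) : ℕ → ℕ → ℂ → A
  | 0, 0, _ => 1
  | 0, o + 1, v => M D E v 1 * sortedWord q D E 0 o (q * v)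
  | z + 1, o, v => M D E v 0 * sortedWord q D E z o (q * v)

/-- The `1` crosses `z` zeros at a cost of `q` each. Parameters stay with positions, so every
crossing again has parameters of ratio `q`. -/
theorem M_one_mul_sortedWord {q : ℂ} (hq : q ≠ 0) {D E : A}
    (hDE : D * E - q • (E * D) = algebraMap ℂ A (1 - q)) (z o : ℕ) {v : ℂ} (hv : v ≠ 0) :
    M D E v 1 * sortedWord q D E z o (q * v) = q ^ z • sortedWord q D E z (o + 1) v := by
  induction z generalizing v with
  | zero => simp [sortedWord]
  | succ z ih =>
    rw [sortedWord, ← mul_assoc, M_one_mul_M_zero hq hDE hv, smul_mul_assoc, mul_assoc,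
      ih (mul_ne_zero hq hv), sortedWord, mul_smul_comm, smul_smul, pow_succ']

theorem weight_cons {n : ℕ} (s : Fin 2) (σ : Fin n → Fin 2) :
    weight (Fin.cons s σ : Fin (n + 1) → Fin 2) = s + weight σ := by
  simp [weight, Fin.sum_univ_succ]

theorem weight_add_card {n : ℕ} (σ : Fin n → Fin 2) :
    weight σ + (Finset.univ.filter fun k => σ k = 0).card = n := by
  rw [weight, Finset.card_filter, ← Finset.sum_add_distrib]
  trans ∑ k : Fin n, 1
  · refine Finset.sum_congr rfl fun k _ => ?_
    generalize σ k = s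
    fin_cases s <;> simp
  · simp

theorem inv_eq_sum {n : ℕ} (σ : Fin n → Fin 2) :
    inv σ = ∑ i, ∑ j, if i < j ∧ σ j < σ i then 1 else 0 := by
  rw [inv, Finset.card_filter, Fintype.sum_prod_type]

theorem inv_cons {n : ℕ} (s : Fin 2) (σ : Fin n → Fin 2) :
    inv (Fin.cons s σ : Fin (n + 1) → Fin 2) =
      (Finset.univ.filter fun k => σ k < s).card + inv σ := by
  simp only [inv_eq_sum, Fin.sum_univ_succ, Finset.card_filter]
  simp

/-- Sort the tail, then insert the first letter: a leading `1` crosses all zeros of the tail, and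
these are exactly the inversions it creates. -/
theorem geomWord_eq {q : ℂ} (hq : q ≠ 0) {D E : A}
    (hDE : D * E - q • (E * D) = algebraMap ℂ A (1 - q)) {n : ℕ} {v : ℂ} (hv : v ≠ 0)
    (σ : Fin n → Fin 2) :
    geomWord q D E n v σ = q ^ inv σ • sortedWord q D E (n - weight σ) (weight σ) v := by
  induction n generalizing v with
  | zero => simp [geomWord, inv, weight, sortedWord]
  | succ n ih =>
    obtain ⟨s, σ, rfl⟩ : ∃ s τ, σ = Fin.cons s τ := ⟨σ 0, Fin.tail σ, (Fin.cons_self_tail σ).symm⟩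
    -- Guarantees that the truncated difference `n - weight σ` is the true number of zeros.
    have hw := weight_add_card σ
    rw [geomWord_cons, ih (mul_ne_zero hq hv), weight_cons, inv_cons, mul_smul_comm]
    fin_cases s
    · have h : n + 1 - weight σ = n - weight σ + 1 := by omega
      simp [h, sortedWord]
    · have h : ∀ k, σ k < 1 ↔ σ k = 0 := fun k => Fin.lt_one_iff _
      have h' : (Finset.univ.filter fun k => σ k = 0).card = n - weight σ := by omega
      have h'' : n + 1 - (1 + weight σ) = n - weight σ := by omega
      simp only [Fin.mk_one, h, h', h'']
      rw [M_one_mul_sortedWord hq hDE _ _ hv, smul_smul, pow_add, mul_comm, add_comm 1]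

theorem geomWord_comm {q : ℂ} (hq : q ≠ 0) {D E : A}
    (hDE : D * E - q • (E * D) = algebraMap ℂ A (1 - q)) {n : ℕ} {v : ℂ} (hv : v ≠ 0)
    {σ τ : Fin n → Fin 2} (h : weight σ = weight τ) :
    q ^ inv τ • geomWord q D E n v σ = q ^ inv σ • geomWord q D E n v τ := by
  rw [geomWord_eq hq hDE hv, geomWord_eq hq hDE hv, h, smul_comm]

/-- Summing `hT` over all `τ` with the weight of `σ` gives `q^{inv σ} (Π T)_ζ = Z T_σ`; then divide
by `Z`. -/
theorem rectAct_inj_rectAct_proj {q : ℂ} {I : ℕ} (hZ : ∀ ζ, Z q I ζ ≠ 0)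
    (T : (Fin I → Fin 2) → A)
    (hT : ∀ σ τ, weight σ = weight τ → q ^ inv τ • T σ = q ^ inv σ • T τ) :
    rectAct (inj q I) (rectAct (proj I) T) = T := by
  funext σ
  have hw : weight σ < I + 1 := by have := weight_add_card σ; omega
  set ζ : Fin (I + 1) := ⟨weight σ, hw⟩ with hζ
  rw [rectAct, Finset.sum_eq_single ζ]
  · have h : q ^ inv σ • rectAct (proj I) T ζ = Z q I ζ • T σ := by
      simp only [rectAct, proj, Z, Matrix.of_apply, Finset.smul_sum, Finset.sum_smul]
      refine Finset.sum_congr rfl fun τ _ => ?_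
      split_ifs with h
      · rw [one_smul, hT σ τ (by rw [h])]
      · simp
    rw [inj, Matrix.of_apply, if_pos (by simp [hζ]), div_eq_inv_mul, mul_smul, h,
      inv_smul_smul₀ (hZ ζ)]
  · intro η _ hη
    rw [inj, Matrix.of_apply, if_neg, zero_smul]
    intro h
    exact hη (Fin.ext h.symm)
  · simp

/-! ### The fused vector as a projection -/

/-- The parameter of the factor `k` in `M^I(u)`. -/
noncomputable def param (r : ℂ) (I : ℕ) (u : ℂ) (k : Fin I) : ℂ :=
  u * r ^ (-((I : ℤ) + 1) + 2 * idx k)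

theorem param_ne_zero {r : ℂ} (hr : r ≠ 0) {I : ℕ} {u : ℂ} (hu : u ≠ 0) (k : Fin I) :
    param r I u k ≠ 0 :=
  mul_ne_zero hu (zpow_ne_zero _ hr)

/-- The vector in `(ℂ²)^{⊗I} ⊗ 𝒜` of which `M^I(u)` is the projection. -/
noncomputable def unfusedM (r : ℂ) (D E : A) (I : ℕ) (u : ℂ) : (Fin I → Fin 2) → A :=
  word D E ((List.finRange I).map fun k => (k, param r I u k))

theorem prodInc_true {I : ℕ} {S : Type*} [Monoid S] (f : Fin I → S) :
    prodInc (fun _ => True) f = ((List.finRange I).map f).prod := by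
  simp [prodInc]

theorem prodDec_true {I : ℕ} {S : Type*} [Monoid S] (f : Fin I → S) :
    prodDec (fun _ => True) f = ((List.finRange I).reverse.map f).prod := by
  simp [prodDec]

theorem fusedM_eq (r : ℂ) (D E : A) (I : ℕ) (u : ℂ) :
    fusedM r D E I u = rectAct (proj I) (unfusedM r D E I u) := by
  funext ζ
  simp only [fusedM, rectAct, proj, Matrix.of_apply, ite_smul, one_smul, zero_smul, prodInc_true,
    unfusedM, word, List.map_map]
  rfl

theorem unfusedM_eq_geomWord {q r : ℂ} (hr0 : r ≠ 0) (hr : r ^ 2 = q) (D E : A) (I : ℕ) (u : ℂ) :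
    unfusedM r D E I u = geomWord q D E I (u * r ^ (1 - (I : ℤ))) := by
  funext σ
  simp only [unfusedM, word, geomWord, List.map_map]
  congr 1
  refine List.map_congr_left fun k _ => ?_
  simp only [Function.comp_def, param]
  congr 1
  -- `idx` starts at `1` and the exponent in `geomWord` at `0`, whence the initial parameter `u
  -- r^{1-I}`.
  rw [← hr, ← zpow_natCast, ← zpow_natCast r, ← zpow_mul, mul_left_comm, ← zpow_add₀ hr0, idx]
  congr 2
  push_cast
  ring

theorem rectAct_inj_fusedM {q r : ℂ} (hq : q ≠ 0) (hr : r ^ 2 = q) {D E : A}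
    (hDE : D * E - q • (E * D) = algebraMap ℂ A (1 - q)) {I : ℕ} (hZ : ∀ ζ, Z q I ζ ≠ 0)
    {u : ℂ} (hu : u ≠ 0) :
    rectAct (inj q I) (fusedM r D E I u) = unfusedM r D E I u := by
  have hr0 : r ≠ 0 := by
    rintro rfl
    exact hq (by simp [← hr])
  rw [fusedM_eq]
  refine rectAct_inj_rectAct_proj hZ _ fun σ τ h => ?_
  rw [unfusedM_eq_geomWord hr0 hr]
  exact geomWord_comm hq hDE (mul_ne_zero hu (zpow_ne_zero _ hr0)) h

end Exchangeability

/-! ### The three relations for the fused vector. -/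

section Fusion

variable {A : Type*} [Ring A] [Algebra ℂ A]

/-! ### The Zamolodchikov–Faddeev relation -/

theorem rectAct_swapOp {ι : Type*} [Fintype ι] [DecidableEq ι] (m : ι × ι → A) (p : ι × ι) :
    rectAct (swapOp ι) m p = m p.swap := by
  rw [rectAct, Finset.sum_eq_single p.swap]
  · simp [swapOp]
  · intro p' _ h
    rw [swapOp, Matrix.of_apply, if_neg, zero_smul]
    rintro rfl
    exact h (Prod.swap_swap p').symm
  · simp

theorem rectAct_inj₂ (q : ℂ) (I : ℕ) (m m' : Fin (I + 1) → A) (σ : Fin (I + I) → Fin 2) :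
    rectAct (inj₂ q I) (tensor m m') σ =
      rectAct (inj q I) m (fstHalf σ) * rectAct (inj q I) m' (sndHalf σ) := by
  simp only [rectAct, inj₂, tensor, Matrix.of_apply, Fintype.sum_prod_type, Finset.sum_mul_sum,
    smul_mul_smul_comm]

/-- After the exchange the word of the second half stands first in the product; `P` compensates for
the crossed components. -/
theorem rectAct_proj₂ (I : ℕ) (T T' : (Fin I → Fin 2) → A) (p : Fin (I + 1) × Fin (I + 1)) :
    rectAct (proj₂ I) (fun σ => T (sndHalf σ) * T' (fstHalf σ)) p =
      rectAct (proj I) T p.2 * rectAct (proj I) T' p.1 := by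
  simp only [rectAct, proj₂, Matrix.of_apply]
  rw [Finset.sum_mul_sum, Finset.sum_comm, ← Fintype.sum_prod_type']
  symm
  refine Fintype.sum_equiv (Fin.appendEquiv I I) _ _ ?_
  rintro ⟨σ, τ⟩
  have h1 : fstHalf (Fin.append σ τ) = σ := funext fun k => Fin.append_left σ τ k
  have h2 : sndHalf (Fin.append σ τ) = τ := funext fun k => Fin.append_right σ τ k
  simp only [Fin.appendEquiv, Equiv.coe_fn_mk, h1, h2]
  rw [smul_mul_smul_comm, mul_comm]

theorem param_div_param {q r : ℂ} (hr0 : r ≠ 0) (hr : r ^ 2 = q) {I : ℕ} {x y : ℂ}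
    (j i : Fin I) : param r I x j / param r I y i = x / y * q ^ (idx j - idx i) := by
  rw [param, param, mul_div_mul_comm, ← zpow_sub₀ hr0, ← hr, ← zpow_natCast, ← zpow_mul]
  congr 2
  push_cast
  ring

/-- The letters of `M^I(x)`, placed in the factors given by `g`. -/
noncomputable def letters {n : ℕ} (r : ℂ) (I : ℕ) (g : Fin I → Fin n) (x : ℂ) : List (Fin n × ℂ) :=
  (List.finRange I).map fun k => (g k, param r I x k)

theorem word_letters {n : ℕ} (r : ℂ) (D E : A) (I : ℕ) (g : Fin I → Fin n) (x : ℂ)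
    (σ : Fin n → Fin 2) : word D E (letters r I g x) σ = unfusedM r D E I x (fun k => σ (g k)) := by
  simp [word, letters, unfusedM, Function.comp_def]

theorem rectAct_fusedROp {q r : ℂ} (hr0 : r ≠ 0) (hr : r ^ 2 = q) {D E : A}
    (hDE : D * E - q • (E * D) = algebraMap ℂ A (1 - q)) {I : ℕ} {x y : ℂ} (hx : x ≠ 0)
    (hy : y ≠ 0) (h : x / y ∉ singFusedR q I) :
    rectAct (fusedROp q I (x / y))
        (fun σ => unfusedM r D E I x (fstHalf σ) * unfusedM r D E I y (sndHalf σ)) =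
      fun σ => unfusedM r D E I y (sndHalf σ) * unfusedM r D E I x (fstHalf σ) := by
  have key := prod_prod_twoSite_R_word hDE [] (letters r I (Fin.castAdd I) x)
    (letters r I (Fin.natAdd I) y)
    (by
      intro s hs
      obtain ⟨k, -, rfl⟩ := List.mem_map.mp hs
      exact param_ne_zero hr0 hx k)
    (by
      intro s hs
      obtain ⟨k, -, rfl⟩ := List.mem_map.mp hs
      exact param_ne_zero hr0 hy k)
    (by
      intro s hs t ht
      obtain ⟨j, -, rfl⟩ := List.mem_map.mp hs
      obtain ⟨i, -, rfl⟩ := List.mem_map.mp ht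
      rw [param_div_param hr0 hr]
      exact fun hn => h ⟨i, j, hn⟩)
    (by
      simp only [letters, List.nil_append, List.map_append, List.map_map, Function.comp_def]
      refine List.Nodup.append
        ((List.nodup_finRange I).map (Fin.castAdd_injective I I))
        ((List.nodup_finRange I).map (Fin.natAdd_injective I I)) ?_
      intro k hk hk'
      obtain ⟨i, -, rfl⟩ := List.mem_map.mp hk
      obtain ⟨j, -, hj⟩ := List.mem_map.mp hk'
      have := congrArg Fin.val hj
      simp at this
      omega)
  simp only [List.nil_append] at key
  have e1 : (fun σ => unfusedM r D E I x (fstHalf σ) * unfusedM r D E I y (sndHalf σ)) =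
      word D E (letters r I (Fin.castAdd I) x ++ letters r I (Fin.natAdd I) y) := by
    funext σ
    rw [word_append, word_letters, word_letters]
    rfl
  have e2 : (fun σ => unfusedM r D E I y (sndHalf σ) * unfusedM r D E I x (fstHalf σ)) =
      word D E (letters r I (Fin.natAdd I) y ++ letters r I (Fin.castAdd I) x) := by
    funext σ
    rw [word_append, word_letters, word_letters]
    rfl
  rw [e1, e2, ← key, fusedROp, prodDec_true]
  simp only [prodInc_true, letters, ← List.map_reverse, List.map_map, Function.comp_def,
    param_div_param hr0 hr]

theorem fusedM_ZFRelation {q r : ℂ} (hq : q ≠ 0) (hr : r ^ 2 = q) {D E : A}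
    (hDE : D * E - q • (E * D) = algebraMap ℂ A (1 - q)) {I : ℕ} (hZ : ∀ ζ, Z q I ζ ≠ 0) :
    ZFRelation (fusedR q I) (singFusedR q I) (fusedM r D E I) := by
  intro x y hx hy h
  have hr0 : r ≠ 0 := by
    rintro rfl
    exact hq (by simp [← hr])
  funext p
  have e : rectAct (inj₂ q I) (tensor (fusedM r D E I x) (fusedM r D E I y)) =
      fun σ => unfusedM r D E I x (fstHalf σ) * unfusedM r D E I y (sndHalf σ) := by
    funext σ
    rw [rectAct_inj₂, rectAct_inj_fusedM hq hr hDE hZ hx, rectAct_inj_fusedM hq hr hDE hZ hy]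
  rw [act_eq_rectAct, rectAct_mul, rectAct_swapOp, fusedR, rectAct_mul, rectAct_mul, e,
    rectAct_fusedROp hr0 hr hDE hx hy h, rectAct_proj₂, ← fusedM_eq, ← fusedM_eq]
  rfl

/-! ### The Ghoshal–Zamolodchikov relations -/

theorem rectAct_reversal (I : ℕ) (m : (Fin I → Fin 2) → A) (σ : Fin I → Fin 2) :
    rectAct (reversal I) m σ = m (σ ∘ Fin.rev) := by
  rw [rectAct, Finset.sum_eq_single (σ ∘ Fin.rev)]
  · rw [reversal, Matrix.of_apply, if_pos, one_smul]
    funext k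
    simp
  · intro τ _ h
    rw [reversal, Matrix.of_apply, if_neg, zero_smul]
    rintro rfl
    apply h
    funext k
    simp
  · simp

/-- The parameter of the factor `k` after its reflection at a boundary. -/
noncomputable def reflParam (r : ℂ) (I : ℕ) (u : ℂ) (k : Fin I) : ℂ :=
  u * r ^ ((I : ℤ) + 1 - 2 * idx k)

theorem reflParam_ne_zero {r : ℂ} (hr : r ≠ 0) {I : ℕ} {u : ℂ} (hu : u ≠ 0) (k : Fin I) :
    reflParam r I u k ≠ 0 :=
  mul_ne_zero hu (zpow_ne_zero _ hr)

theorem param_one_div (r : ℂ) (I : ℕ) (u : ℂ) (k : Fin I) :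
    param r I (1 / u) k = 1 / reflParam r I u k := by
  rw [param, reflParam, ← div_div, div_eq_mul_inv (1 / u), ← zpow_neg]
  congr 2
  ring

/-- Reflection reverses the geometric progression, so reversing the factors yields the parameters of
`M^I(u)`. -/
theorem reflParam_rev (r : ℂ) (I : ℕ) (u : ℂ) (k : Fin I) :
    reflParam r I u k.rev = param r I u k := by
  rw [param, reflParam]
  congr 2
  have := k.isLt
  simp only [idx, Fin.val_rev]
  omega

theorem reflParam_mul {q r : ℂ} (hr0 : r ≠ 0) (hr : r ^ 2 = q) (I : ℕ) (u : ℂ) (j i : Fin I) :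
    reflParam r I u j * reflParam r I u i = u ^ 2 * q ^ ((I : ℤ) + 1 - idx i - idx j) := by
  rw [reflParam, reflParam, mul_mul_mul_comm, ← sq, ← zpow_add₀ hr0, ← hr, ← zpow_natCast r,
    ← zpow_mul]
  congr 2
  push_cast
  ring

theorem unfusedM_one_div (r : ℂ) (D E : A) (I : ℕ) (u : ℂ) :
    unfusedM r D E I (1 / u) =
      word D E ((List.finRange I).map fun k => (k, 1 / reflParam r I u k)) := by
  simp only [unfusedM, param_one_div]

theorem unfusedM_eq_reverse (r : ℂ) (D E : A) (I : ℕ) (u : ℂ) (σ : Fin I → Fin 2) :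
    word D E ((List.finRange I).reverse.map fun k => (k, reflParam r I u k)) (σ ∘ Fin.rev) =
      unfusedM r D E I u σ := by
  simp [word, unfusedM, List.finRange_reverse, Function.comp_def, reflParam_rev]

/-- Translates the index conditions of the inner fusion products into the prefixes and suffixes used
by the word inductions. -/
theorem filter_finRange_of_eq_append {I : ℕ} {l l' : List (Fin I)} {i : Fin I}
    (h : List.finRange I = l ++ i :: l') :
    (List.finRange I).filter (fun j => j < i) = l ∧
      (List.finRange I).filter (fun j => i < j) = l' := by
  have hs := List.pairwise_lt_finRange I
  rw [h, List.pairwise_append, List.pairwise_cons] at hs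
  obtain ⟨-, ⟨h1, -⟩, h2⟩ := hs
  have h3 : ∀ j ∈ l, j < i := fun j hj => h2 j hj i (by simp)
  rw [h, List.filter_append, List.filter_append, List.filter_cons, List.filter_cons,
    List.filter_eq_self.mpr (by simpa using h3),
    List.filter_eq_nil_iff.mpr (by simpa using fun j hj => (h1 j hj).le),
    List.filter_eq_nil_iff.mpr (by simpa using fun j hj => (h3 j hj).le),
    List.filter_eq_self.mpr (by simpa using h1)]
  simp

theorem fusedK_mul_fusedM {q r : ℂ} (hq : q ≠ 0) (hr : r ^ 2 = q) {D E : A}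
    (hDE : D * E - q • (E * D) = algebraMap ℂ A (1 - q)) {I : ℕ} (hZ : ∀ ζ, Z q I ζ ≠ 0)
    {a c : ℂ} (N : Submodule ℂ A) (hN : ∀ x ∈ N, ∀ y, x * y ∈ N) (hK : a • E - c • D + 1 ∈ N)
    {u : ℂ} (hu : u ≠ 0) (h : u ∉ singFusedK q r a c I) (ζ : Fin (I + 1)) :
    act (fusedK q r a c I u) (fusedM r D E I (1 / u)) ζ - fusedM r D E I u ζ ∈ N := by
  have hr0 : r ≠ 0 := by
    rintro rfl
    exact hq (by simp [← hr])
  rw [act_eq_rectAct, fusedK, rectAct_mul, rectAct_mul,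
    rectAct_inj_fusedM hq hr hDE hZ (one_div_ne_zero hu), fusedM_eq]
  refine rectAct_sub_mem N _ (fun σ => ?_) ζ
  rw [fusedKOp, rectAct_mul, rectAct_reversal, prodDec_true, unfusedM_one_div,
    ← unfusedM_eq_reverse]
  have key := prod_K_R_word hDE N hN hK (reflParam r I u)
    (fun i => oneSite (K a c (u * r ^ ((I : ℤ) + 1 - 2 * idx i))) i *
        prodDec (fun j : Fin I => j < i) fun j =>
          twoSite (R q (u ^ 2 * q ^ ((I : ℤ) + 1 - idx i - idx j))) j i)
    (List.finRange I) (List.nodup_finRange I)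
    (fun i _ => ⟨reflParam_ne_zero hr0 hu i, fun hn => h (Or.inl ⟨i, hn⟩)⟩)
    (by
      intro l i l' hl
      have hf := (filter_finRange_of_eq_append hl).1
      refine ⟨fun j hj hn => h (Or.inr ⟨i, j, ?_, ?_⟩), ?_⟩
      · rw [← hf] at hj
        simpa using (List.mem_filter.mp hj).2
      · rwa [← reflParam_mul hr0 hr]
      · simp only [prodDec, reflParam_mul hr0 hr, hf]
        rfl)
    (List.finRange I) [] (by simp) (σ ∘ Fin.rev)
  simpa using key

theorem fusedKbar_mul_fusedM {q r : ℂ} (hq : q ≠ 0) (hr : r ^ 2 = q) {D E : A}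
    (hDE : D * E - q • (E * D) = algebraMap ℂ A (1 - q)) {I : ℕ} (hZ : ∀ ζ, Z q I ζ ≠ 0)
    {b d : ℂ} (N : Submodule ℂ A) (hN : ∀ x ∈ N, ∀ y, y * x ∈ N) (hK : b • D - d • E + 1 ∈ N)
    {u : ℂ} (hu : u ≠ 0) (h : u ∉ singFusedKbar q r b d I) (ζ : Fin (I + 1)) :
    act (fusedKbar q r b d I u) (fusedM r D E I (1 / u)) ζ - fusedM r D E I u ζ ∈ N := by
  have hr0 : r ≠ 0 := by
    rintro rfl
    exact hq (by simp [← hr])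
  rw [act_eq_rectAct, fusedKbar, rectAct_mul, rectAct_mul,
    rectAct_inj_fusedM hq hr hDE hZ (one_div_ne_zero hu), fusedM_eq]
  refine rectAct_sub_mem N _ (fun σ => ?_) ζ
  rw [fusedKbarOp, rectAct_mul, rectAct_reversal, prodInc_true, unfusedM_one_div,
    ← unfusedM_eq_reverse]
  have key := prod_Kbar_Rinv_word hDE N hN hK (reflParam r I u)
    (fun i => oneSite (Kbar b d (u * r ^ ((I : ℤ) + 1 - 2 * idx i))) i *
        prodInc (fun j : Fin I => i < j) fun j =>
          twoSite (Rinv q (u ^ 2 * q ^ ((I : ℤ) + 1 - idx i - idx j))) j i)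
    (List.finRange I) (List.nodup_finRange I)
    (fun i _ => ⟨reflParam_ne_zero hr0 hu i, fun hn => h (Or.inl ⟨i, hn⟩)⟩)
    (by
      intro l i l' hl
      have hf := (filter_finRange_of_eq_append hl).2
      refine ⟨fun j hj hn => h (Or.inr ⟨i, j, ?_, ?_⟩), ?_⟩
      · rw [← hf] at hj
        simpa using (List.mem_filter.mp hj).2
      · rwa [← reflParam_mul hr0 hr]
      · simp only [prodInc, reflParam_mul hr0 hr, hf]
        rfl)
    [] (List.finRange I) (by simp) (σ ∘ Fin.rev)
  simpa using key

end Fusion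

end FusedVertex

/-! ### Specialisation of `N` to the annihilators of `⟨W|` and `|V⟩`. -/

theorem mainTheorem4 {A : Type*} [Ring A] [Algebra ℂ A] {H : Type*} [AddCommGroup H] [Module ℂ H]
    (ρ : A →ₐ[ℂ] Module.End ℂ H) (W : Module.Dual ℂ H) (V : H)
    (I : ℕ) (hI : 1 ≤ I)
    (q r : ℂ) (hq : q ≠ 0) (hr : r ^ 2 = q) (hZ : ∀ ζ : Fin (I + 1), FusedVertex.Z q I ζ ≠ 0)
    (a b c d : ℂ) (D E : A)
    (hDE : D * E - q • (E * D) = algebraMap ℂ A (1 - q))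
    (hW : W ∘ₗ ρ (a • E - c • D + 1) = 0)
    (hV : ρ (b • D - d • E + 1) V = 0) :
    FusedVertex.ZFRelation (FusedVertex.fusedR q I) (FusedVertex.singFusedR q I)
        (FusedVertex.fusedM r D E I) ∧
      FusedVertex.FirstGZRelation (FusedVertex.fusedK q r a c I)
        (FusedVertex.singFusedK q r a c I) ρ W (FusedVertex.fusedM r D E I) ∧
      FusedVertex.SecondGZRelation (FusedVertex.fusedKbar q r b d I)
        (FusedVertex.singFusedKbar q r b d I) ρ V (FusedVertex.fusedM r D E I) := by
  let NW : Submodule ℂ A := LinearMap.ker ((LinearMap.compRight ℂ W) ∘ₗ ρ.toLinearMap)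
  let NV : Submodule ℂ A := LinearMap.ker ((LinearMap.applyₗ V) ∘ₗ ρ.toLinearMap)
  have mem_NW : ∀ x, x ∈ NW ↔ W ∘ₗ ρ x = 0 := fun x => Iff.rfl
  have mem_NV : ∀ x, x ∈ NV ↔ ρ x V = 0 := fun x => Iff.rfl
  refine ⟨FusedVertex.fusedM_ZFRelation hq hr hDE hZ, fun u hu h ζ => ?_, fun u hu h ζ => ?_⟩
  · rw [← mem_NW]
    refine FusedVertex.fusedK_mul_fusedM hq hr hDE hZ NW (fun x hx y => ?_) hW hu h ζ
    rw [mem_NW] at hx ⊢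
    rw [map_mul, Module.End.mul_eq_comp, ← LinearMap.comp_assoc, hx, LinearMap.zero_comp]
  · rw [← mem_NV]
    refine FusedVertex.fusedKbar_mul_fusedM hq hr hDE hZ NV (fun x hx y => ?_) hV hu h ζ
    rw [mem_NV] at hx ⊢
    rw [map_mul, Module.End.mul_apply, hx, map_zero]
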